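/- Let the scalar field be $\mathbb{R}$ or $\mathbb{C}$, and let $c_0\subset\ell_\infty$ denote the subspace of null sequences. A Banach space $X$ is a Grothendieck space if every $\sigma(X^*,X)$-convergent sequence in $X^*$ is $\sigma(X^*,X^{**})$-convergent. A closed subspace $S$ of $\ell_\infty$ is an $\ell_\infty$-Grothendieck subspace if $c_0\subset S$ and every $\sigma(S^*,S)$-convergent sequence in $S^*$ is $\sigma(S^*,\ell_\infty)$-convergent, where $\ell_\infty\equiv c_0^{**}$ is identified with the subspace $j^{**}(c_0^{**})$ of $S^{**}$, $j:c_0\to S$ being the inclusion map. Let $Y$ be a closed subspace of $\ell_\infty$ which is a Grothendieck space, and let $M\subset Y$ be a subspace isomorphic (linearly homeomorphic) to $c_0$. Then there exists an $\ell_\infty$-Grothendieck subspace $S$ isomorphic to $Y$. Moreover, $S$ can be chosen as $S=\Phi(Y)$ for some linear homeomorphism $\Phi$ of $\ell_\infty$ onto itself with $\Phi(M)=c_0$. -/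

import Mathlib

open Filter Topology
open scoped ENNReal lp

/-- The Banach space `ℓ_∞` of bounded scalar sequences, with the supremum norm. -/
abbrev LInf (𝕜 : Type*) [RCLike 𝕜] : Type _ := lp (fun _ : ℕ => 𝕜) ∞

/-- `c₀`, the subspace of `ℓ_∞` of the sequences that converge to `0`. -/
def czero (𝕜 : Type*) [RCLike 𝕜] : Submodule 𝕜 (LInf 𝕜) where
  carrier := {x | Tendsto (fun n : ℕ => x n) atTop (𝓝 0)}
  zero_mem' := by
    change Tendsto (fun _ : ℕ => (0 : 𝕜)) atTop (𝓝 0)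
    exact tendsto_const_nhds
  add_mem' := by
    intro x y hx hy
    have h := Tendsto.add hx hy
    rw [add_zero] at h
    exact h
  smul_mem' := by
    intro c x hx
    have h := Tendsto.const_smul hx c
    rw [smul_zero] at h
    exact h

section

variable {𝕜 : Type*} [RCLike 𝕜]

/-- `X` is `M`-Grothendieck, for a vector subspace `M` of the bidual `X**`: every sequence in `X*`
that converges for `σ(X*, X)` converges for `σ(X*, M)`, to the same limit.
(The notion is meant for `X ⊆ M`, where the two limits agree automatically.) -/
def IsMGrothendieck {X : Type*} [NormedAddCommGroup X] [NormedSpace 𝕜 X]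
    (M : Submodule 𝕜 (StrongDual 𝕜 (StrongDual 𝕜 X))) : Prop :=
  ∀ (f : ℕ → StrongDual 𝕜 X) (g : StrongDual 𝕜 X),
    (∀ x : X, Tendsto (fun n => f n x) atTop (𝓝 (g x))) →
      ∀ m ∈ M, Tendsto (fun n => m (f n)) atTop (𝓝 (m g))

variable (𝕜) in
/-- `X` is a Grothendieck space: every `σ(X*, X)`-convergent sequence in `X*` is
`σ(X*, X**)`-convergent. -/
def IsGrothendieckSpace (X : Type*) [NormedAddCommGroup X] [NormedSpace 𝕜 X] : Prop :=
  IsMGrothendieck (⊤ : Submodule 𝕜 (StrongDual 𝕜 (StrongDual 𝕜 X)))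

/-- The adjoint `T* : F* → E*`, `T* φ = φ ∘ T`, of a bounded operator `T : E → F`. -/
noncomputable def adjointMap {E F : Type*} [NormedAddCommGroup E] [NormedSpace 𝕜 E]
    [NormedAddCommGroup F] [NormedSpace 𝕜 F] (T : E →L[𝕜] F) :
    StrongDual 𝕜 F →L[𝕜] StrongDual 𝕜 E :=
  ContinuousLinearMap.precomp 𝕜 T

/-- The second adjoint `T** : E** → F**` of a bounded operator `T : E → F`. -/
noncomputable def biadjointMap {E F : Type*} [NormedAddCommGroup E] [NormedSpace 𝕜 E]
    [NormedAddCommGroup F] [NormedSpace 𝕜 F] (T : E →L[𝕜] F) :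
    StrongDual 𝕜 (StrongDual 𝕜 E) →L[𝕜] StrongDual 𝕜 (StrongDual 𝕜 F) :=
  adjointMap (adjointMap T)

/-- For `c₀ ⊆ S ⊆ ℓ_∞`, the inclusion map `j : c₀ → S`. -/
noncomputable def czeroIncl {S : Submodule 𝕜 (LInf 𝕜)} (h : czero 𝕜 ≤ S) : czero 𝕜 →L[𝕜] S :=
  ⟨Submodule.inclusion h, continuous_inclusion h⟩

/-- For `c₀ ⊆ S ⊆ ℓ_∞`, the copy `j**(c₀**)` of `ℓ_∞ = c₀**` inside `S**`. -/
noncomputable def linfInBidual {S : Submodule 𝕜 (LInf 𝕜)} (h : czero 𝕜 ≤ S) :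
    Submodule 𝕜 (StrongDual 𝕜 (StrongDual 𝕜 S)) :=
  (biadjointMap (czeroIncl h)).range

/-- `S` is an `ℓ_∞`-Grothendieck subspace: `S` is closed in `ℓ_∞`, it contains `c₀`, and every
`σ(S*, S)`-convergent sequence in `S*` is `σ(S*, ℓ_∞)`-convergent, where `ℓ_∞` is identified
with `j**(c₀**) ⊆ S**`. -/
def IsLInfGrothendieckSubspace (S : Submodule 𝕜 (LInf 𝕜)) : Prop :=
  IsClosed (S : Set (LInf 𝕜)) ∧ ∃ h : czero 𝕜 ≤ S, IsMGrothendieck (linfInBidual h)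

end

/-!
The theorem is a case of the Lindenstrauss–Rosenthal theorem on extending isomorphisms between
subspaces of `ℓ_∞`: every copy `M` of `c₀` in `ℓ_∞` is carried onto `c₀` by an automorphism `Φ` of
`ℓ_∞` (`exists_automorphism_map_eq_czero`). Granted this, `S = Φ(Y)` is closed, contains
`c₀ = Φ(M)`, and is a Grothendieck space because `Y` is; so weak-star convergent sequences in `S*`
converge against all of `S**`, in particular against `j**(c₀**)`.

To construct `Φ`, extend an isomorphism `M → c₀` and its inverse to operators `A`, `B` on `ℓ_∞`
(`exists_extension_LInf`). The main point is that `ℓ_∞ / M` contains a complemented copy of `ℓ_∞`: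
there are operators `i`, `r` on `ℓ_∞` with `r i = id` and `r = 0` on `M = B c₀`
(`exists_rightInverse_vanishing`). Indeed, the matrix `(B e_k)(m)` has rows bounded in `ℓ₁` and
columns bounded below. A gliding hump (`exists_almost_biorthogonal`) yields functionals `φ_n`,
multiples of differences of two coordinates, and indices `k_n` such that `φ_n → 0` pointwise on `M`
and `φ_n (∑ x_l B e_{k_l}) - x_n → 0` for all `x ∈ ℓ_∞`. Let `r` take the limits of `φ_n` along
ultrafilters living on infinitely many disjoint infinite sets of indices `n`, and let `i` use
sequences `x` that are constant on each of these sets.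

Since `ℓ_∞ ≃ ℓ_∞ × ker r` and `ℓ_∞ ≃ ℓ_∞ × ℓ_∞`, there is an isomorphism of `ℓ_∞` onto its square
that is `x ↦ (0, x)` on `M` (`exists_equiv_prod_of_ker`); the same holds for `c₀` in place of `M`.
On the square, shears by `A` and `-B` carry `(0, B y)` to `(B y, y)` and on to `(0, y)`, which
makes the two positions match (`exists_equiv_eqOn`).
-/

section

variable {𝕜 : Type*} [RCLike 𝕜]

/-! ### Almost biorthogonal differences of rows -/

/-- A bounded scalar sequence converges along every ultrafilter. -/
lemma exists_tendsto_ultrafilter (U : Ultrafilter ℕ) {x : ℕ → 𝕜} {C : ℝ} (hx : ∀ n, ‖x n‖ ≤ C) :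
    ∃ l : 𝕜, Tendsto x U (𝓝 l) := by
  obtain ⟨l, -, hl⟩ := (isCompact_closedBall (0 : 𝕜) C).ultrafilter_le_nhds (U.map x)
    (le_principal_iff.2 (Ultrafilter.mem_coe.2
      (U.sets_of_superset univ_mem fun n _ => mem_closedBall_zero_iff.2 (hx n))))
  exact ⟨l, hl⟩

lemma summable_norm_of_sum_le {a : ℕ → 𝕜} {C : ℝ} (ha : ∀ F : Finset ℕ, ∑ k ∈ F, ‖a k‖ ≤ C) :
    Summable fun k => ‖a k‖ :=
  summable_of_sum_le (fun _ => norm_nonneg _) ha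

/-- One step of the gliding hump. The rows of the matrix are bounded in `ℓ₁`, and every column has
an entry of modulus at least `δ`; then some difference of two rows has an entry of modulus at least
`δ / 2` in a window `[N, N')`, and total mass at most `ε` outside of it. -/
lemma exists_row_sub_concentrated {a : ℕ → ℕ → 𝕜} {C δ : ℝ}
    (ha : ∀ m (F : Finset ℕ), ∑ k ∈ F, ‖a m k‖ ≤ C) (hδ : 0 < δ)
    (h : ∀ k, ∃ m, δ ≤ ‖a m k‖) (N : ℕ) {ε : ℝ} (hε : 0 < ε) :
    ∃ m m' k N' : ℕ, N ≤ k ∧ k < N' ∧ δ / 2 ≤ ‖a m k - a m' k‖ ∧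
      ∀ G : Finset ℕ, (∀ j ∈ G, j < N ∨ N' ≤ j) → ∑ j ∈ G, ‖a m j - a m' j‖ ≤ ε := by
  choose μ hμ using h
  let U : Ultrafilter ℕ := hyperfilter ℕ
  have hU : (U : Filter ℕ) ≤ atTop := Nat.hyperfilter_le_atTop
  have hb : ∀ m k, ‖a m k‖ ≤ C := fun m k => by simpa using ha m {k}
  choose v hv using fun j => exists_tendsto_ultrafilter U (x := fun n => a (μ n) j) (fun n => hb _ _)
  -- The limit row `v` is again in `ℓ₁`, so its entries tend to `0`.
  have hvs : Summable fun j => ‖v j‖ := summable_norm_of_sum_le (C := C) fun F =>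
    le_of_tendsto (tendsto_finsetSum F fun j _ => (hv j).norm)
      (Eventually.of_forall fun n => ha (μ n) F)
  have hv0 : ∀ᶠ k in (U : Filter ℕ), ‖v k‖ < δ / 4 :=
    hU (hvs.tendsto_atTop_zero.eventually_lt_const (by positivity))
  have hhead : ∀ᶠ n in (U : Filter ℕ), ∑ j ∈ Finset.range N, ‖a (μ n) j - v j‖ < ε / 4 := by
    have : Tendsto (fun n => ∑ j ∈ Finset.range N, ‖a (μ n) j - v j‖) U (𝓝 0) := by
      simpa using tendsto_finsetSum (Finset.range N) fun j _ => ((hv j).sub_const (v j)).norm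
    exact this.eventually_lt_const (by positivity)
  obtain ⟨k, hk1, hk2, hk3⟩ := (hv0.and (hhead.and (hU (eventually_ge_atTop N)))).exists
  have hent : ∀ᶠ n in (U : Filter ℕ), ‖a (μ n) k - v k‖ < δ / 4 := by
    have : Tendsto (fun n => ‖a (μ n) k - v k‖) U (𝓝 0) := by
      simpa using ((hv k).sub_const (v k)).norm
    exact this.eventually_lt_const (by positivity)
  obtain ⟨n, hn1, hn2⟩ := (hent.and hhead).exists
  have hds : Summable fun j => ‖a (μ k) j - a (μ n) j‖ :=
    Summable.of_nonneg_of_le (fun _ => norm_nonneg _) (fun _ => norm_sub_le _ _)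
      ((summable_norm_of_sum_le (ha (μ k))).add (summable_norm_of_sum_le (ha (μ n))))
  obtain ⟨s, hs⟩ := summable_iff_vanishing_norm.1 hds (ε / 2) (by positivity)
  refine ⟨μ k, μ n, k, max k (s.sup id) + 1, hk3, by omega, ?_, fun G hG => ?_⟩
  · have h1 : ‖a (μ k) k‖ ≤ ‖a (μ k) k - a (μ n) k‖ + ‖a (μ n) k - v k‖ + ‖v k‖ := by
      calc ‖a (μ k) k‖ = ‖(a (μ k) k - a (μ n) k) + (a (μ n) k - v k) + v k‖ := by
            congr 1; ring
        _ ≤ _ := norm_add₃_le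
    linarith [hμ k]
  · rw [← Finset.sum_filter_add_sum_filter_not G (· < N)]
    have h1 : ∑ j ∈ G with j < N, ‖a (μ k) j - a (μ n) j‖ ≤ ε / 2 := by
      calc ∑ j ∈ G with j < N, ‖a (μ k) j - a (μ n) j‖
          ≤ ∑ j ∈ Finset.range N, ‖a (μ k) j - a (μ n) j‖ :=
            Finset.sum_le_sum_of_subset_of_nonneg (fun j hj => by simp_all)
              fun _ _ _ => norm_nonneg _
        _ ≤ ∑ j ∈ Finset.range N, (‖a (μ k) j - v j‖ + ‖a (μ n) j - v j‖) :=
            Finset.sum_le_sum fun j _ => by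
              rw [← dist_eq_norm, ← dist_eq_norm, ← dist_eq_norm]
              exact dist_triangle_right _ _ _
        _ ≤ ε / 2 := by rw [Finset.sum_add_distrib]; linarith
    have h2 : ∑ j ∈ G with ¬ j < N, ‖a (μ k) j - a (μ n) j‖ ≤ ε / 2 := by
      refine (le_abs_self _).trans (hs _ ?_).le
      rw [Finset.disjoint_left]
      intro j hj hjs
      rw [Finset.mem_filter] at hj
      have h3 := (hG j hj.1).resolve_left hj.2
      have h4 : j ≤ s.sup id := Finset.le_sup (f := id) hjs
      omega
    linarith

/-- The gliding hump: differences of rows which, along the columns `k n`, are almost diagonal, and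
which tend to `0` in every column of the matrix. -/
lemma exists_almost_biorthogonal {a : ℕ → ℕ → 𝕜} {C δ : ℝ}
    (ha : ∀ m (F : Finset ℕ), ∑ k ∈ F, ‖a m k‖ ≤ C) (hδ : 0 < δ)
    (h : ∀ k, ∃ m, δ ≤ ‖a m k‖) :
    ∃ m m' k : ℕ → ℕ, Function.Injective k ∧
      (∀ n, δ / 2 ≤ ‖a (m n) (k n) - a (m' n) (k n)‖) ∧
      (∀ j, Tendsto (fun n => a (m n) j - a (m' n) j) atTop (𝓝 0)) ∧
      ∃ ε : ℕ → ℝ, Tendsto ε atTop (𝓝 0) ∧ ∀ n (F : Finset ℕ), n ∉ F →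
        ∑ l ∈ F, ‖a (m n) (k l) - a (m' n) (k l)‖ ≤ ε n := by
  choose m m' k N' hk1 hk2 hk3 hk4 using fun N : ℕ =>
    exists_row_sub_concentrated ha hδ h N (Nat.one_div_pos_of_nat (α := ℝ) (n := N))
  let N : ℕ → ℕ := fun n => N'^[n] 0
  have hNs : ∀ n, N (n + 1) = N' (N n) := fun n => Function.iterate_succ_apply' _ _ _
  have hN : StrictMono N := strictMono_nat_of_lt_succ fun n => by
    rw [hNs]; exact (hk1 _).trans_lt (hk2 _)
  have hε : Tendsto (fun n => 1 / ((N n : ℝ) + 1)) atTop (𝓝 0) :=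
    (tendsto_one_div_add_atTop_nhds_zero_nat (𝕜 := ℝ)).comp hN.tendsto_atTop
  have hkN : ∀ {l n}, l < n → k (N l) < N n := fun {l n} hln =>
    (hk2 _).trans_le ((hNs l).symm.le.trans (hN.monotone hln))
  have hkm : StrictMono fun n => k (N n) := fun l n hln => (hkN hln).trans_le (hk1 _)
  refine ⟨fun n => m (N n), fun n => m' (N n), fun n => k (N n), hkm.injective,
    fun n => hk3 _, fun j => ?_, fun n => 1 / ((N n : ℝ) + 1), hε, fun n F hF => ?_⟩
  · refine squeeze_zero_norm' ?_ hε
    filter_upwards [eventually_gt_atTop j] with n hn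
    simpa using hk4 (N n) {j} (by simpa using Or.inl (hn.trans_le hN.le_apply))
  · have := hk4 (N n) (F.image fun l => k (N l)) (by
      intro j hj
      obtain ⟨l, hl, rfl⟩ := Finset.mem_image.1 hj
      rcases lt_trichotomy l n with hln | rfl | hln
      · exact Or.inl (hkN hln)
      · exact absurd hl hF
      · exact Or.inr ((hNs n).symm.le.trans ((hN.monotone hln).trans (hk1 _))))
    rwa [Finset.sum_image (hkm.injective.injOn)] at this

/-! ### Operators into `ℓ_∞` -/

/-- The bounded operator `y ↦ (f n y)_n` into `ℓ_∞` given by a bounded sequence of functionals. -/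
noncomputable def operatorOfFunctionals {E : Type*} [NormedAddCommGroup E] [NormedSpace 𝕜 E]
    (f : ℕ → StrongDual 𝕜 E) (C : ℝ) (hf : ∀ n, ‖f n‖ ≤ C) : E →L[𝕜] LInf 𝕜 :=
  LinearMap.mkContinuous
    { toFun := fun y => ⟨fun n => f n y, memℓp_infty ⟨C * ‖y‖, by
        rintro _ ⟨n, rfl⟩
        exact (f n).le_of_opNorm_le (hf n) y⟩⟩
      map_add' := fun x y => lp.ext (funext fun n => (f n).map_add x y)
      map_smul' := fun c x => lp.ext (funext fun n => (f n).map_smul c x) }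
    C fun y => lp.norm_le_of_forall_le
      (mul_nonneg ((norm_nonneg _).trans (hf 0)) (norm_nonneg _))
      fun n => (f n).le_of_opNorm_le (hf n) y

@[simp]
lemma operatorOfFunctionals_apply {E : Type*} [NormedAddCommGroup E] [NormedSpace 𝕜 E]
    (f : ℕ → StrongDual 𝕜 E) (C : ℝ) (hf : ∀ n, ‖f n‖ ≤ C) (y : E) (n : ℕ) :
    operatorOfFunctionals f C hf y n = f n y := rfl

lemma LInf.norm_apply_le (y : LInf 𝕜) (n : ℕ) : ‖y n‖ ≤ ‖y‖ :=
  lp.norm_apply_le_norm ENNReal.top_ne_zero y n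

variable (𝕜) in
/-- The `n`-th coordinate functional on `ℓ_∞`. -/
noncomputable def coordFunctional (n : ℕ) : StrongDual 𝕜 (LInf 𝕜) :=
  lp.evalCLM 𝕜 (fun _ : ℕ => 𝕜) ∞ n

@[simp]
lemma coordFunctional_apply (n : ℕ) (y : LInf 𝕜) : coordFunctional 𝕜 n y = y n := rfl

lemma norm_coordFunctional_le (n : ℕ) : ‖coordFunctional 𝕜 n‖ ≤ 1 :=
  ContinuousLinearMap.opNorm_le_bound _ zero_le_one fun y => by
    rw [one_mul]; exact LInf.norm_apply_le y n

/-- `ℓ_∞` is injective: by the Hahn–Banach theorem in each coordinate, bounded operators into it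
extend from subspaces. -/
lemma exists_extension_LInf {E : Type*} [NormedAddCommGroup E] [NormedSpace 𝕜 E]
    (p : Submodule 𝕜 E) (T : p →L[𝕜] LInf 𝕜) :
    ∃ A : E →L[𝕜] LInf 𝕜, ∀ x : p, A x = T x := by
  choose g hg hgn using fun n => exists_extension_norm_eq p ((coordFunctional 𝕜 n).comp T)
  refine ⟨operatorOfFunctionals g ‖T‖ fun n => ?_, fun x => lp.ext (funext fun n => hg n x)⟩
  rw [hgn]
  refine (ContinuousLinearMap.opNorm_comp_le _ _).trans ?_
  exact mul_le_of_le_one_left (norm_nonneg _) (norm_coordFunctional_le n)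

/-- The limit along an ultrafilter is a bounded functional on `ℓ_∞`. -/
lemma exists_ultrafilter_functional (U : Ultrafilter ℕ) :
    ∃ Λ : StrongDual 𝕜 (LInf 𝕜), ‖Λ‖ ≤ 1 ∧ ∀ y : LInf 𝕜, Tendsto (fun n => y n) U (𝓝 (Λ y)) := by
  choose Λ hΛ using fun y : LInf 𝕜 =>
    exists_tendsto_ultrafilter U (x := fun n => y n) (LInf.norm_apply_le y)
  refine ⟨LinearMap.mkContinuous
    { toFun := Λ
      map_add' := fun x y => tendsto_nhds_unique (hΛ (x + y)) ((hΛ x).add (hΛ y))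
      map_smul' := fun c x => tendsto_nhds_unique (hΛ (c • x)) ((hΛ x).const_smul c) } 1
      fun y => ?_, LinearMap.mkContinuous_norm_le _ zero_le_one _, hΛ⟩
  rw [one_mul]
  exact le_of_tendsto (hΛ y).norm (Eventually.of_forall (LInf.norm_apply_le y))

/-- The functional on `ℓ_∞` given by an element of `ℓ₁`. -/
lemma exists_functional_of_summable {a : ℕ → 𝕜} {C : ℝ}
    (ha : ∀ F : Finset ℕ, ∑ k ∈ F, ‖a k‖ ≤ C) :
    ∃ f : StrongDual 𝕜 (LInf 𝕜), ‖f‖ ≤ C ∧ ∀ y : LInf 𝕜, HasSum (fun k => a k * y k) (f y) := by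
  have hs := summable_norm_of_sum_le ha
  have hle : ∀ (y : LInf 𝕜) k, ‖a k * y k‖ ≤ ‖a k‖ * ‖y‖ := fun y k => by
    rw [norm_mul]; gcongr; exact LInf.norm_apply_le y k
  have hsum : ∀ y : LInf 𝕜, Summable fun k => a k * y k := fun y =>
    Summable.of_norm_bounded (hs.mul_right ‖y‖) (hle y)
  refine ⟨LinearMap.mkContinuous
    { toFun := fun y => ∑' k, a k * y k
      map_add' := fun x y => by
        rw [← (hsum x).tsum_add (hsum y)]
        exact tsum_congr fun k => mul_add _ _ _
      map_smul' := fun c x => by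
        rw [RingHom.id_apply, smul_eq_mul, ← tsum_mul_left]
        exact tsum_congr fun k => mul_left_comm _ _ _ } C fun y => ?_,
    LinearMap.mkContinuous_norm_le _ (by simpa using ha ∅) _, fun y => (hsum y).hasSum⟩
  calc ‖∑' k, a k * y k‖ ≤ ∑' k, ‖a k‖ * ‖y‖ :=
        tsum_of_norm_bounded (hs.mul_right _).hasSum (hle y)
    _ = (∑' k, ‖a k‖) * ‖y‖ := tsum_mul_right
    _ ≤ C * ‖y‖ := by gcongr; exact hs.tsum_le_of_sum_le ha

/-! ### The unit vectors of `c₀` -/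

variable (𝕜) in
/-- The unit vector `e_k` of `c₀`. -/
noncomputable def unitVector (k : ℕ) : LInf 𝕜 := lp.single ∞ k (1 : 𝕜)

lemma unitVector_apply (k n : ℕ) : unitVector 𝕜 k n = if n = k then 1 else 0 := by
  simp [unitVector, lp.single_apply, Pi.single_apply]

lemma norm_unitVector (k : ℕ) : ‖unitVector 𝕜 k‖ = 1 := by
  rw [unitVector, lp.norm_single (by simp)]; exact norm_one

lemma unitVector_mem_czero (k : ℕ) : unitVector 𝕜 k ∈ czero 𝕜 := by
  change Tendsto _ _ _
  refine tendsto_const_nhds.congr' ?_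
  filter_upwards [eventually_gt_atTop k] with n hn
  rw [unitVector_apply, if_neg hn.ne']

lemma sum_smul_unitVector_apply (F : Finset ℕ) (s : ℕ → 𝕜) (n : ℕ) :
    (∑ k ∈ F, s k • unitVector 𝕜 k) n = if n ∈ F then s n else 0 := by
  rw [← coordFunctional_apply, map_sum]
  simp [unitVector_apply]

/-- The partial sums of a null sequence converge to it in norm. -/
lemma tendsto_sum_smul_unitVector {x : LInf 𝕜} (hx : x ∈ czero 𝕜) :
    Tendsto (fun n => ∑ k ∈ Finset.range n, x k • unitVector 𝕜 k) atTop (𝓝 x) := by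
  have hx' : Tendsto (fun n => x n) atTop (𝓝 0) := hx
  refine Metric.tendsto_atTop.2 fun ε hε => ?_
  obtain ⟨N, hN⟩ := Metric.tendsto_atTop.1 hx' (ε / 2) (by positivity)
  refine ⟨N, fun n hn => lt_of_le_of_lt ?_ (half_lt_self hε)⟩
  rw [dist_eq_norm]
  refine lp.norm_le_of_forall_le (by positivity) fun j => ?_
  rw [lp.coeFn_sub, Pi.sub_apply, sum_smul_unitVector_apply]
  split_ifs with hj
  · simpa using (half_pos hε).le
  · have h := hN j (hn.trans (by simpa using hj))
    rw [dist_zero_right] at h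
    rw [zero_sub, norm_neg]
    exact h.le

/-- An operator that kills the unit vectors kills `c₀`. -/
lemma eq_zero_of_unitVector {E : Type*} [NormedAddCommGroup E] [NormedSpace 𝕜 E]
    (T : LInf 𝕜 →L[𝕜] E) (hT : ∀ k, T (unitVector 𝕜 k) = 0) {x : LInf 𝕜} (hx : x ∈ czero 𝕜) :
    T x = 0 := by
  refine tendsto_nhds_unique ((T.continuous.tendsto x).comp (tendsto_sum_smul_unitVector hx)) ?_
  simp [Function.comp_def, hT]

/-- The series `∑ T e_k` is weakly unconditionally Cauchy: each coordinate of it is in `ℓ₁`. -/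
lemma sum_norm_apply_unitVector_le (T : LInf 𝕜 →L[𝕜] LInf 𝕜) (m : ℕ) (F : Finset ℕ) :
    ∑ k ∈ F, ‖T (unitVector 𝕜 k) m‖ ≤ ‖T‖ := by
  -- Multiply by unimodular scalars that make the coordinates nonnegative.
  choose s hs1 hs2 using fun k => RCLike.exists_norm_eq_mul_self (T (unitVector 𝕜 k) m)
  have h1 : ‖∑ k ∈ F, s k • unitVector 𝕜 k‖ ≤ 1 := by
    refine lp.norm_le_of_forall_le zero_le_one fun n => ?_
    rw [sum_smul_unitVector_apply]
    split_ifs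
    · exact (hs1 n).le
    · simp
  have h2 : ((∑ k ∈ F, ‖T (unitVector 𝕜 k) m‖ : ℝ) : 𝕜) = T (∑ k ∈ F, s k • unitVector 𝕜 k) m := by
    rw [← coordFunctional_apply, map_sum, map_sum, RCLike.ofReal_sum]
    refine Finset.sum_congr rfl fun k _ => ?_
    rw [hs2, map_smul, map_smul, coordFunctional_apply, smul_eq_mul]
  calc ∑ k ∈ F, ‖T (unitVector 𝕜 k) m‖
      = ‖((∑ k ∈ F, ‖T (unitVector 𝕜 k) m‖ : ℝ) : 𝕜)‖ := by
        rw [RCLike.norm_ofReal, abs_of_nonneg (Finset.sum_nonneg fun _ _ => norm_nonneg _)]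
    _ ≤ ‖T (∑ k ∈ F, s k • unitVector 𝕜 k)‖ := by rw [h2]; exact LInf.norm_apply_le _ _
    _ ≤ ‖T‖ := T.unit_le_opNorm _ h1

/-! ### A copy of `ℓ_∞` complemented modulo a copy of `c₀` -/

/-- Let `B : ℓ_∞ → ℓ_∞` be bounded below on the unit vectors of `c₀`. Then there is a bounded
operator `r` from `ℓ_∞` onto `ℓ_∞`, with a bounded right inverse `i`, that vanishes on `B c₀`. -/
lemma exists_rightInverse_vanishing (B : LInf 𝕜 →L[𝕜] LInf 𝕜) {δ : ℝ} (hδ : 0 < δ)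
    (hB : ∀ k, δ < ‖B (unitVector 𝕜 k)‖) :
    ∃ i r : LInf 𝕜 →L[𝕜] LInf 𝕜, (∀ z, r (i z) = z) ∧ ∀ x ∈ czero 𝕜, r (B x) = 0 := by
  let a : ℕ → ℕ → 𝕜 := fun m k => B (unitVector 𝕜 k) m
  have ha : ∀ m (F : Finset ℕ), ∑ k ∈ F, ‖a m k‖ ≤ ‖B‖ := sum_norm_apply_unitVector_le B
  have hcol : ∀ k, ∃ m, δ ≤ ‖a m k‖ := fun k => by
    by_contra! hlt
    exact (hB k).not_ge (lp.norm_le_of_forall_le hδ.le fun m => (hlt m).le)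
  obtain ⟨m, m', k, hk, hdiag, hnull, ε, hε, hoff⟩ := exists_almost_biorthogonal ha hδ hcol
  -- The functionals `φ n`, normalized so that `φ n (B e_{k n}) = 1`.
  let c : ℕ → 𝕜 := fun n => (a (m n) (k n) - a (m' n) (k n))⁻¹
  have hc : ∀ n, ‖c n‖ ≤ 2 / δ := fun n => by
    rw [norm_inv, ← inv_div]
    exact inv_anti₀ (by positivity) (hdiag n)
  let φ : ℕ → StrongDual 𝕜 (LInf 𝕜) := fun n =>
    c n • (coordFunctional 𝕜 (m n) - coordFunctional 𝕜 (m' n))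
  have hφ : ∀ n y, φ n y = c n * (y (m n) - y (m' n)) := fun _ _ => rfl
  have hφn : ∀ n, ‖φ n‖ ≤ 2 / δ * (1 + 1) := fun n => by
    have h1 : ‖coordFunctional 𝕜 (m n) - coordFunctional 𝕜 (m' n)‖ ≤ 1 + 1 :=
      norm_sub_le_of_le (norm_coordFunctional_le _) (norm_coordFunctional_le _)
    have h2 := norm_smul_le (c n) (coordFunctional 𝕜 (m n) - coordFunctional 𝕜 (m' n))
    exact h2.trans (mul_le_mul (hc n) h1 (norm_nonneg _) (by positivity))
  -- The operator `x ↦ ∑ x_l B e_{k l}`, the sum being taken coordinatewise.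
  choose ρ hρn hρ using fun m => exists_functional_of_summable (a := fun l => a m (k l))
    (C := ‖B‖) fun F => by simpa [Finset.sum_map] using ha m (F.map ⟨k, hk⟩)
  let B' := operatorOfFunctionals ρ ‖B‖ hρn
  have hB' : ∀ x : LInf 𝕜, Tendsto (fun n => φ n (B' x) - x n) atTop (𝓝 0) := by
    intro x
    have hlim : Tendsto (fun n => 2 / δ * (ε n * ‖x‖)) atTop (𝓝 0) := by
      simpa using (hε.mul_const ‖x‖).const_mul (2 / δ)
    refine squeeze_zero_norm (fun n => ?_) hlim
    have hs := (hρ (m n) x).sub (hρ (m' n) x)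
    have hne : a (m n) (k n) - a (m' n) (k n) ≠ 0 := fun h0 => by
      have := hdiag n
      rw [h0, norm_zero] at this
      linarith
    have hval : φ n (B' x) - x n = c n * (ρ (m n) x - ρ (m' n) x -
        (a (m n) (k n) * x n - a (m' n) (k n) * x n)) := by
      have h1 : c n * (a (m n) (k n) - a (m' n) (k n)) = 1 := inv_mul_cancel₀ hne
      have h2 : φ n (B' x) = c n * (ρ (m n) x - ρ (m' n) x) := rfl
      rw [h2]
      linear_combination x n * h1
    rw [hval, norm_mul]
    refine mul_le_mul (hc n) ?_ (norm_nonneg _) (by positivity)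
    -- What is left is the part of the sum off the diagonal.
    refine le_of_tendsto (hs.sub_const _).norm ?_
    filter_upwards [eventually_ge_atTop {n}] with F hF
    rw [← Finset.add_sum_erase F _ (Finset.singleton_subset_iff.1 hF), add_sub_cancel_left]
    calc ‖∑ l ∈ F.erase n, (a (m n) (k l) * x l - a (m' n) (k l) * x l)‖
        ≤ ∑ l ∈ F.erase n, ‖a (m n) (k l) - a (m' n) (k l)‖ * ‖x‖ :=
          norm_sum_le_of_le _ fun l _ => by
            rw [← sub_mul, norm_mul]; gcongr; exact LInf.norm_apply_le x l
      _ ≤ ε n * ‖x‖ := by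
          rw [← Finset.sum_mul]; gcongr; exact hoff n _ (Finset.notMem_erase n F)
  -- The ultrafilters `U p` live on the disjoint infinite blocks `{n | n.unpair.1 = p}`.
  let U : ℕ → Ultrafilter ℕ := fun p => (hyperfilter ℕ).map (Nat.pair p)
  have hpair : ∀ p, Function.Injective (Nat.pair p) := fun p x y h => by
    simpa using congrArg (fun n => n.unpair.2) h
  have hU : ∀ p, (U p : Filter ℕ) ≤ atTop := fun p =>
    (Tendsto.mono_left (hpair p).nat_tendsto_atTop Nat.hyperfilter_le_atTop)
  choose Λ hΛn hΛ using fun p => exists_ultrafilter_functional (𝕜 := 𝕜) (U p)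
  let Φ := operatorOfFunctionals φ _ hφn
  let r := operatorOfFunctionals (fun p => (Λ p).comp Φ) (1 * ‖Φ‖) fun p =>
    ((Λ p).opNorm_comp_le Φ).trans (by gcongr; exact hΛn p)
  have hr : ∀ y p, Tendsto (fun n => φ n y) (U p) (𝓝 (r y p)) := fun y p => hΛ p (Φ y)
  -- The operator `J` repeats the `p`-th coordinate on the `p`-th block.
  let J : LInf 𝕜 →L[𝕜] LInf 𝕜 := operatorOfFunctionals (fun n => coordFunctional 𝕜 n.unpair.1) 1
    fun n => norm_coordFunctional_le _
  refine ⟨B'.comp J, r, fun z => lp.ext (funext fun p => ?_), fun x hx => ?_⟩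
  · have h1 : Tendsto (fun n => J z n) (U p) (𝓝 (z p)) := by
      refine tendsto_map'_iff.2 (tendsto_const_nhds.congr fun n => ?_)
      simp [J]
    have h2 := ((hB' (J z)).mono_left (hU p)).add h1
    rw [zero_add] at h2
    exact tendsto_nhds_unique (hr _ p) (by simpa using h2)
  · refine eq_zero_of_unitVector (r.comp B) (fun j => lp.ext (funext fun p => ?_)) hx
    refine tendsto_nhds_unique (hr _ p) (Tendsto.mono_left ?_ (hU p))
    have hlim : Tendsto (fun n => 2 / δ * ‖a (m n) j - a (m' n) j‖) atTop (𝓝 0) := by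
      simpa using (hnull j).norm.const_mul (2 / δ)
    refine squeeze_zero_norm (fun n => ?_) hlim
    rw [hφ, norm_mul]
    exact mul_le_mul_of_nonneg_right (hc n) (norm_nonneg _)

/-! ### Extension of isomorphisms between subspaces to automorphisms -/

variable (𝕜) in
/-- `ℓ_∞` is isomorphic to its square, by splitting into even and odd coordinates. -/
lemma nonempty_LInf_prod_equiv : Nonempty (LInf 𝕜 ≃L[𝕜] LInf 𝕜 × LInf 𝕜) := by
  let f : LInf 𝕜 →L[𝕜] LInf 𝕜 × LInf 𝕜 :=
    (operatorOfFunctionals (fun n => coordFunctional 𝕜 (2 * n)) 1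
      fun _ => norm_coordFunctional_le _).prod
    (operatorOfFunctionals (fun n => coordFunctional 𝕜 (2 * n + 1)) 1
      fun _ => norm_coordFunctional_le _)
  let g : LInf 𝕜 × LInf 𝕜 →L[𝕜] LInf 𝕜 :=
    operatorOfFunctionals (fun n => if Even n
      then (coordFunctional 𝕜 (n / 2)).comp (ContinuousLinearMap.fst 𝕜 (LInf 𝕜) (LInf 𝕜))
      else (coordFunctional 𝕜 (n / 2)).comp (ContinuousLinearMap.snd 𝕜 (LInf 𝕜) (LInf 𝕜)))
      (1 * 1) fun n => by
        split_ifs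
        · exact (ContinuousLinearMap.opNorm_comp_le _ _).trans
            (mul_le_mul (norm_coordFunctional_le _) (ContinuousLinearMap.norm_fst_le ..)
              (norm_nonneg _) zero_le_one)
        · exact (ContinuousLinearMap.opNorm_comp_le _ _).trans
            (mul_le_mul (norm_coordFunctional_le _) (ContinuousLinearMap.norm_snd_le ..)
              (norm_nonneg _) zero_le_one)
  refine ⟨ContinuousLinearEquiv.equivOfInverse f g (fun x => ?_) fun y => ?_⟩
  · refine lp.ext (funext fun n => ?_)
    rcases n.even_or_odd' with ⟨k, rfl | rfl⟩
    · simp [f, g]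
    · have : (2 * k + 1) / 2 = k := by omega
      simp [f, g, this]
  · refine Prod.ext (lp.ext (funext fun n => ?_)) (lp.ext (funext fun n => ?_))
    · simp [f, g]
    · have : (2 * n + 1) / 2 = n := by omega
      simp [f, g, this]

/-- If `E` is isomorphic to its square and `r : E → E` has a right inverse, then some isomorphism
of `E` onto `E × E` places the kernel of `r` in the second factor. -/
lemma exists_equiv_prod_of_ker {E : Type*} [NormedAddCommGroup E] [NormedSpace 𝕜 E]
    (e : E ≃L[𝕜] E × E) (i r : E →L[𝕜] E) (h : ∀ z, r (i z) = z) :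
    ∃ Ψ : E ≃L[𝕜] E × E, ∀ x, r x = 0 → Ψ x = (0, x) := by
  -- `E ≃ E × ker r ≃ (E × E) × ker r ≃ E × (E × ker r) ≃ E × E`.
  let d := ContinuousLinearEquiv.equivOfRightInverse r i h
  refine ⟨d.trans ((e.prodCongr (.refl 𝕜 _)).trans
    ((ContinuousLinearEquiv.prodAssoc 𝕜 E E r.ker).trans
      ((ContinuousLinearEquiv.refl 𝕜 E).prodCongr d.symm))), fun x hx => ?_⟩
  have hd : d x = (0, ⟨x, hx⟩) := Prod.ext hx (Subtype.ext (by simp [d, hx]))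
  have hd' : d.symm (0, ⟨x, hx⟩) = x := by rw [← hd, d.symm_apply_apply]
  simp [hd, hd']

/-- Let `B` and `A` be operators on `E` that are inverse to one another between `N` and `B N`. If
there are isomorphisms of `E` onto `E × E` that place `B N`, respectively `N`, in the second
factor, then `A` agrees on `B N` with an automorphism of `E`. -/
lemma exists_equiv_eqOn {E : Type*} [NormedAddCommGroup E] [NormedSpace 𝕜 E]
    (N : Submodule 𝕜 E) (A B : E →L[𝕜] E) (hAB : ∀ y ∈ N, A (B y) = y)
    (Ψ Ψ' : E ≃L[𝕜] E × E) (hΨ : ∀ y ∈ N, Ψ (B y) = (0, B y)) (hΨ' : ∀ y ∈ N, Ψ' y = (0, y)) :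
    ∃ Φ : E ≃L[𝕜] E, ∀ y ∈ N, Φ (B y) = y := by
  -- The shears carry `(0, B y)` to `(B y, y)` and then to `(0, y)`, up to a swap of the factors.
  let sA : (E × E) ≃L[𝕜] E × E := (ContinuousLinearEquiv.refl 𝕜 E).skewProd (.refl 𝕜 E) A
  let sB : (E × E) ≃L[𝕜] E × E := (ContinuousLinearEquiv.refl 𝕜 E).skewProd (.refl 𝕜 E) (-B)
  let sw : (E × E) ≃L[𝕜] E × E := ContinuousLinearEquiv.prodComm 𝕜 E E
  refine ⟨Ψ.trans (sw.trans (sA.trans (sw.trans (sB.trans (sw.trans Ψ'.symm))))), fun y hy => ?_⟩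
  simp [hΨ y hy, sA, sB, sw, hAB y hy, ContinuousLinearEquiv.symm_apply_eq, hΨ' y hy]

/-! ### Isomorphic invariance of the Grothendieck property -/

lemma IsGrothendieckSpace.of_equiv {X Z : Type*} [NormedAddCommGroup X] [NormedSpace 𝕜 X]
    [NormedAddCommGroup Z] [NormedSpace 𝕜 Z] (e : X ≃L[𝕜] Z) (hX : IsGrothendieckSpace 𝕜 X) :
    IsGrothendieckSpace 𝕜 Z := by
  intro f g hfg m _
  have key := hX (fun n => (f n).comp (e : X →L[𝕜] Z)) (g.comp (e : X →L[𝕜] Z))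
    (fun x => hfg (e x)) (biadjointMap (e.symm : Z →L[𝕜] X) m) trivial
  have h : ∀ u : StrongDual 𝕜 Z,
      biadjointMap (e.symm : Z →L[𝕜] X) m (u.comp (e : X →L[𝕜] Z)) = m u := fun u => by
    change m ((u.comp (e : X →L[𝕜] Z)).comp (e.symm : Z →L[𝕜] X)) = m u
    congr 1
    ext z
    simp
  simpa only [h] using key

/-! ### Automorphisms of `ℓ_∞` and copies of `c₀` -/

/-- A copy `B c₀` of `c₀` in `ℓ_∞` lies in the second factor for a suitable isomorphism of `ℓ_∞`
onto its square. -/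
lemma exists_equiv_prod_of_copy_czero (A B : LInf 𝕜 →L[𝕜] LInf 𝕜)
    (hAB : ∀ y ∈ czero 𝕜, A (B y) = y) :
    ∃ Ψ : LInf 𝕜 ≃L[𝕜] LInf 𝕜 × LInf 𝕜, ∀ y ∈ czero 𝕜, Ψ (B y) = (0, B y) := by
  have hB : ∀ k, (‖A‖ + 1)⁻¹ < 2 * ‖B (unitVector 𝕜 k)‖ := fun k => by
    have h1 : 1 ≤ ‖A‖ * ‖B (unitVector 𝕜 k)‖ := by
      rw [← norm_unitVector (𝕜 := 𝕜) k]
      conv_lhs => rw [← hAB _ (unitVector_mem_czero k)]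
      exact A.le_opNorm _
    have h2 : 0 < ‖A‖ + 1 := by positivity
    rw [inv_lt_iff_one_lt_mul₀ h2]
    nlinarith [norm_nonneg A, norm_nonneg (B (unitVector 𝕜 k))]
  obtain ⟨i, r, hri, hr⟩ := exists_rightInverse_vanishing B (δ := (‖A‖ + 1)⁻¹ / 2) (by positivity)
    fun k => by linarith [hB k]
  obtain ⟨e⟩ := nonempty_LInf_prod_equiv 𝕜
  obtain ⟨Ψ, hΨ⟩ := exists_equiv_prod_of_ker e i r hri
  exact ⟨Ψ, fun y hy => hΨ _ (hr y hy)⟩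

/-- Every subspace of `ℓ_∞` that is isomorphic to `c₀` is mapped onto `c₀` by an automorphism
of `ℓ_∞`. -/
lemma exists_automorphism_map_eq_czero (M : Submodule 𝕜 (LInf 𝕜)) (T : M ≃L[𝕜] czero 𝕜) :
    ∃ Φ : LInf 𝕜 ≃L[𝕜] LInf 𝕜, M.map (Φ : LInf 𝕜 →ₗ[𝕜] LInf 𝕜) = czero 𝕜 := by
  obtain ⟨A, hA⟩ := exists_extension_LInf M ((czero 𝕜).subtypeL.comp (T : M →L[𝕜] czero 𝕜))
  obtain ⟨B, hB⟩ := exists_extension_LInf (czero 𝕜) (M.subtypeL.comp (T.symm : czero 𝕜 →L[𝕜] M))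
  have hB' : ∀ y : czero 𝕜, B y = T.symm y := hB
  have hAB : ∀ y ∈ czero 𝕜, A (B y) = y := fun y hy => by
    rw [hB' ⟨y, hy⟩, hA]; simp
  obtain ⟨Ψ, hΨ⟩ := exists_equiv_prod_of_copy_czero A B hAB
  obtain ⟨Ψ', hΨ'⟩ := exists_equiv_prod_of_copy_czero (.id 𝕜 (LInf 𝕜)) (.id 𝕜 (LInf 𝕜))
    fun _ _ => rfl
  obtain ⟨Φ, hΦ⟩ := exists_equiv_eqOn (czero 𝕜) A B hAB Ψ Ψ' hΨ hΨ'
  refine ⟨Φ, le_antisymm ?_ fun y hy => ⟨B y, ?_, hΦ y hy⟩⟩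
  · rintro _ ⟨x, hx, rfl⟩
    have h1 : B (T ⟨x, hx⟩) = x := by rw [hB', T.symm_apply_apply]
    have h2 := hΦ _ (T ⟨x, hx⟩).2
    rw [h1] at h2
    change Φ x ∈ czero 𝕜
    rw [h2]
    exact (T ⟨x, hx⟩).2
  · rw [hB' ⟨y, hy⟩]
    exact (T.symm ⟨y, hy⟩).2

end

theorem proposition3p4 {𝕜 : Type*} [RCLike 𝕜]
    (Y : Submodule 𝕜 (LInf 𝕜)) (hYclosed : IsClosed (Y : Set (LInf 𝕜)))
    (hY : IsGrothendieckSpace 𝕜 Y)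
    (M : Submodule 𝕜 (LInf 𝕜)) (hMY : M ≤ Y) (hM : Nonempty (M ≃L[𝕜] czero 𝕜)) :
    ∃ S : Submodule 𝕜 (LInf 𝕜),
      IsLInfGrothendieckSubspace S ∧ Nonempty (Y ≃L[𝕜] S) ∧
        ∃ Φ : LInf 𝕜 ≃L[𝕜] LInf 𝕜,
          M.map (Φ : LInf 𝕜 →ₗ[𝕜] LInf 𝕜) = czero 𝕜 ∧
          Y.map (Φ : LInf 𝕜 →ₗ[𝕜] LInf 𝕜) = S := by
  obtain ⟨T⟩ := hM
  obtain ⟨Φ, hΦ⟩ := exists_automorphism_map_eq_czero M T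
  let e : Y ≃L[𝕜] Y.map (Φ : LInf 𝕜 →ₗ[𝕜] LInf 𝕜) := Φ.submoduleMap Y
  refine ⟨_, ⟨?_, ?_, ?_⟩, ⟨e⟩, Φ, hΦ, rfl⟩
  · exact Φ.toHomeomorph.isClosedMap _ hYclosed
  · exact hΦ ▸ Submodule.map_mono hMY
  · exact fun f g hfg m _ => hY.of_equiv e f g hfg m trivial
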